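/- Let $B$ be the full binary tree of height $\omega_1+2$: its nodes are all transfinite sequences $f:\beta\to\{0,1\}$ with $\beta<\omega_1+2$, ordered by $f\le g$ iff $g$ extends $f$. For an element $x$ of a tree $T$, $\mathrm{ht}(x,T)$ is the order type of the set of strict predecessors of $x$ in $T$, the $\alpha$-th level of $T$ consists of the $x\in T$ with $\mathrm{ht}(x,T)=\alpha$, and $y$ is an immediate successor of $x$ if $x<y$ and $\mathrm{ht}(y,T)=\mathrm{ht}(x,T)+1$. The coarse wedge topology on $T$ is the topology with subbase consisting of all sets $V_t=\{s\in T: s\ge t\}$ and their complements, where $t$ is minimal or on a successor level. A retractional skeleton in a compact Hausdorff space $K$ is a family of continuous retractions $(r_s)_{s\in\Gamma}$ of $K$, indexed by a nonempty up-directed partially ordered set $\Gamma$, such that (i) each $r_s[K]$ is metrizable and compact; (ii) $s\le t$ implies $r_s=r_t\circ r_s=r_s\circ r_t$; (iii) if $s_0\le s_1\le\cdots$ in $\Gamma$, then $t=\sup_n s_n$ exists and $r_t(x)=\lim_n r_{s_n}(x)$ for every $x\in K$; (iv) $x=\lim_{s\in\Gamma}r_s(x)$ for every $x\in K$. A compact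 Hausdorff space $K$ is Valdivia if there are a dense set $A\subset K$, a set $\Gamma$ and a homeomorphic embedding $h:K\to[0,1]^\Gamma$ such that $h(A)$ is the set of those points of $h(K)$ that have at most countably many nonzero coordinates. Let $T\subset B$ be a subtree which contains all nodes of $B$ on levels $\alpha\le\omega_1$ and in which every node on level $\omega_1$ has exactly one immediate successor; such subtrees exist. Then $T$, endowed with the coarse wedge topology, is a compact Hausdorff space such that 1. $T$ has a retractional skeleton; 2. $T$ contains no homeomorphic copy of the ordinal space $[0,\omega_2]$ with the interval topology; 3. $T$ is not Valdivia. Consequently, it is not true that every compact Hausdorff space which has a retractional skeleton and contains no homeomorphic copy of $[0,\omega_2]$ is Valdivia. -/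

import Mathlib

open Topology Filter

universe u

/-! ### Trees and the coarse wedge topology -/

/-- A tree: a partial order in which the strict predecessors of every element are well-ordered
by `<`. -/
class IsTreeOrder (T : Type u) [PartialOrder T] : Prop where
  isWellOrder_Iio : ∀ x : T, IsWellOrder (Set.Iio x) (· < ·)

section Tree

variable {T : Type u} [PartialOrder T] [IsTreeOrder T]

/-- The height of `x`: the order type of the set of its strict predecessors. -/
noncomputable def treeHeight (x : T) : Ordinal.{u} :=
  @Ordinal.type (Set.Iio x) (· < ·) (IsTreeOrder.isWellOrder_Iio x)

variable (T) in
/-- The `α`-th level of the tree `T`. -/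
def treeLevel (α : Ordinal.{u}) : Set T := {x | treeHeight x = α}

/-- The set of the immediate successors of `x`. -/
def immediateSuccs (x : T) : Set T := {y | x < y ∧ treeHeight y = treeHeight x + 1}

/-- `t` is minimal, or it is on a successor level. -/
def IsMinOrSuccLevel (t : T) : Prop := IsMin t ∨ ∃ β : Ordinal.{u}, treeHeight t = β + 1

variable (T) in
/-- The coarse wedge topology: it is generated by the wedges `V_t = {s | t ≤ s}` and their
complements, where `t` is minimal or on a successor level. -/
@[reducible] def coarseWedgeTopology : TopologicalSpace T :=
  TopologicalSpace.generateFrom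
    {U | ∃ t : T, IsMinOrSuccLevel t ∧ (U = Set.Ici t ∨ U = (Set.Ici t)ᶜ)}

/-- A subset of a tree, with the induced order, is a tree. -/
instance isTreeOrder_subset (S : Set T) : IsTreeOrder S where
  isWellOrder_Iio x := by
    have := IsTreeOrder.isWellOrder_Iio (x : T)
    let f : Set.Iio x ↪o Set.Iio (x : T) :=
      OrderEmbedding.ofMapLEIff (fun y => ⟨(y : S), y.2⟩) fun _ _ => Iff.rfl
    exact f.ltEmbedding.isWellOrder

end Tree

/-! ### The full `κ`-ary tree of height `α` -/

/-- The nodes of the full `κ`-ary tree of height `α`: the transfinite sequences `β → κ` with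
`β < α`. Here `α.ToType` is the well-ordered set of the ordinals less than `α`, the length `β`
is an element of it, and the sequence is defined on the elements less than `β`. -/
@[ext] structure FullTree (κ : Type u) (α : Ordinal.{u}) : Type u where
  /-- the length (domain) of the sequence -/
  dom : α.ToType
  /-- the sequence itself -/
  val : Set.Iio dom → κ

namespace FullTree

variable {κ : Type u} {α : Ordinal.{u}}

/-- `f ≤ g` means that `g` extends `f`. -/
instance : PartialOrder (FullTree κ α) where
  le f g := ∃ h : f.dom ≤ g.dom, ∀ i : Set.Iio f.dom, g.val ⟨i, lt_of_lt_of_le i.2 h⟩ = f.val i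
  le_refl f := ⟨le_rfl, fun _ => rfl⟩
  le_trans f g k := by
    rintro ⟨h, hv⟩ ⟨h', hv'⟩
    exact ⟨h.trans h', fun i => (hv' ⟨i, lt_of_lt_of_le i.2 h⟩).trans (hv i)⟩
  le_antisymm f g := by
    obtain ⟨d, v⟩ := f
    obtain ⟨e, w⟩ := g
    rintro ⟨h, hv⟩ ⟨h', _⟩
    obtain rfl : d = e := le_antisymm h h'
    congr 1
    funext i
    exact (hv i).symm

theorem le_def {f g : FullTree κ α} : f ≤ g ↔
    ∃ h : f.dom ≤ g.dom, ∀ i : Set.Iio f.dom, g.val ⟨i, lt_of_lt_of_le i.2 h⟩ = f.val i :=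
  Iff.rfl

/-- Among the predecessors of a node, the order is the order of the lengths. -/
theorem le_of_dom_le {f g k : FullTree κ α} (hf : f ≤ k) (hg : g ≤ k) (h : f.dom ≤ g.dom) :
    f ≤ g := by
  obtain ⟨h₁, hv₁⟩ := hf
  obtain ⟨h₂, hv₂⟩ := hg
  exact ⟨h, fun i => (hv₂ ⟨i, lt_of_lt_of_le i.2 h⟩).symm.trans (hv₁ i)⟩

instance : IsTreeOrder (FullTree κ α) where
  isWellOrder_Iio x := by
    let f : Set.Iio x ↪o α.ToType :=
      OrderEmbedding.ofMapLEIff (fun y => (y : FullTree κ α).dom) fun a b =>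
        ⟨fun h => le_of_dom_le a.2.le b.2.le h, fun h => h.1⟩
    exact f.ltEmbedding.isWellOrder

end FullTree

/-- `T` is a subtree of the binary tree of height `ω₁ + 2` which contains all nodes of the binary
tree on the levels up to `ω₁`, and in which every node on level `ω₁` has exactly one immediate
successor. -/
structure IsOneSuccessorSubtree (T : Set (FullTree (Fin 2) (Ordinal.omega 1 + 2))) : Prop where
  mem_of_height_le : ∀ f : FullTree (Fin 2) (Ordinal.omega 1 + 2),
    treeHeight f ≤ Ordinal.omega 1 → f ∈ T
  existsUnique_succ : ∀ t ∈ treeLevel T (Ordinal.omega 1), ∃! s : T, s ∈ immediateSuccs t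

/-! ### Valdivia compacta, retractional skeletons, copies of `[0, ω₂]` -/

/-- `A` is a `Σ`-subset of `K`: for some embedding `h` of `K` into a cube `[0,1]^Γ`, the image of
`A` consists of the points of `h(K)` that have at most countably many nonzero coordinates. -/
def IsSigmaSubset {K : Type u} [TopologicalSpace K] (A : Set K) : Prop :=
  ∃ (Γ : Type u) (h : K → Γ → unitInterval), IsEmbedding h ∧
    h '' A = Set.range h ∩ {x | {γ | x γ ≠ 0}.Countable}

/-- A (compact) space is Valdivia if it has a dense `Σ`-subset. -/
def IsValdivia (K : Type u) [TopologicalSpace K] : Prop :=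
  ∃ A : Set K, Dense A ∧ IsSigmaSubset A

/-- `r` is a retractional skeleton in the (compact) space `K`, indexed by the (nonempty)
up-directed partially ordered set `Γ`. -/
structure IsRetractionalSkeleton {K : Type u} [TopologicalSpace K] {Γ : Type u} [PartialOrder Γ]
    (r : Γ → K → K) : Prop where
  nonempty : Nonempty Γ
  directed : ∀ s t : Γ, ∃ v, s ≤ v ∧ t ≤ v
  continuous : ∀ s, Continuous (r s)
  retraction : ∀ s, r s ∘ r s = r s
  isCompact_range : ∀ s, IsCompact (Set.range (r s))
  metrizable_range : ∀ s, TopologicalSpace.MetrizableSpace (Set.range (r s))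
  comp_eq : ∀ s t, s ≤ t → r t ∘ r s = r s ∧ r s ∘ r t = r s
  exists_sup : ∀ s : ℕ → Γ, Monotone s → ∃ t, IsLUB (Set.range s) t ∧
    ∀ x, Tendsto (fun n => r (s n) x) atTop (𝓝 (r t x))
  tendsto_id : ∀ x, Tendsto (fun s => r s x) atTop (𝓝 x)

/-- The space `K` has a retractional skeleton. -/
def HasRetractionalSkeleton (K : Type u) [TopologicalSpace K] : Prop :=
  ∃ (Γ : Type u) (_ : PartialOrder Γ) (r : Γ → K → K), IsRetractionalSkeleton r

/-- `X` contains a copy of the ordinal space `[0, ω₂]` with the interval topology. -/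
def ContainsOmegaTwoCopy (X : Type u) [TopologicalSpace X] : Prop :=
  ∃ f : Set.Iic (Ordinal.omega 2 : Ordinal.{0}) → X, IsEmbedding f

/-!
A node of a one-successor subtree `T` is determined by the nodes on successor levels below it
(`eq_of_forall_isSucc`), and every chain in `T` has a supremum (`exists_sup`). So sending a node
to the set of its predecessors on successor levels identifies `T` with the space of all
downward closed chains of such nodes, a closed subset of a Cantor cube; this gives compactness
and the Hausdorff property.

*Retractional skeleton.* For a set `A` of nodes on successor levels let `retract A x` be the
supremum of the elements of `A` below `x`. These maps automatically commute and are compatible with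
increasing unions of sets. If `A` contains, with any two distinct elements, their common
predecessors on successor levels, then the preimage of every wedge is a wedge or empty, so
`retract A` is continuous (`continuous_retract`); if `A` is countable, its range embeds into the
metrizable cube `A → Bool`. The countable sets with this closure property are cofinal among all
countable sets because two distinct nodes on successor levels have only countably many common
predecessors (`countable_le_and_le`). This is where it matters that a node on level `ω₁` has only
one immediate successor.

*No copy of `[0, ω₂]`.* Every point of `T` has at most `ℵ₁` predecessors and at most two immediate
successors, so it is the intersection of at most `ℵ₁` open sets (`exists_isOpen_iInter_eq`), while
by regularity of `ω₂` the last point of `[0, ω₂]` is not.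

*Not Valdivia.* A leaf, that is, a node of length `ω₁ + 1`, is isolated, so it lies in every dense
set. Hence it suffices that for every embedding `h` of `T` into a cube some leaf has
uncountably many nonzero coordinates (`exists_leaf_not_countable`). Let `nonvanishing h s` be the
set of the coordinates that vanish nowhere on the wedge of `s`; it grows with `s`, and it is
contained in the support of every leaf above `s`. If all these supports are countable, then, on the
one hand, every node on a countable level has an extension with strictly more nonvanishing
coordinates (`exists_not_nonvanishing_subset`): for a node `x` on level `ω₁` above `s`, the
countably many coordinates in `nonvanishing h s` agree at `x` and at some predecessor `w` of `x`
on a countable limit level, so another coordinate separates `w` from `x`; it is nonzero at one of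
them, hence on a whole wedge branching off just below. On the other hand, along a branch of
length `ω₁` the nonvanishing coordinates are eventually constant (`exists_lt_nonvanishing_subset`).
Zorn's lemma produces a branch along which they keep growing, a contradiction.
-/

open Order Set
open scoped Ordinal Cardinal

/-! ### Lengths and digits of nodes -/

/-- The height is the only function `len` on a tree that maps the predecessors of every node `t`
isomorphically onto the ordinals less than `len t`. -/
theorem treeHeight_eq_of_len {T : Type u} [PartialOrder T] [IsTreeOrder T] (len : T → Ordinal.{u})
    (mono : ∀ ⦃a b : T⦄, a < b → len a < len b)
    (le_of_len : ∀ ⦃t a b : T⦄, a < t → b < t → len a ≤ len b → a ≤ b)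
    (surj : ∀ (t : T), ∀ β < len t, ∃ s < t, len s = β) (t : T) : treeHeight t = len t := by
  have := IsTreeOrder.isWellOrder_Iio t
  let e : Iio t → Iio (len t) := fun s => ⟨len s, mono s.2⟩
  have hle : ∀ a b : Iio t, e a ≤ e b ↔ a ≤ b := fun a b =>
    ⟨fun h => le_of_len a.2 b.2 h, fun h => by
      rcases eq_or_lt_of_le (show a.1 ≤ b.1 from h) with h | h
      · exact (congrArg len h).le
      · exact (mono h).le⟩
  have hlt : ∀ a b : Iio t, e a < e b ↔ a < b := fun a b => by
    rw [lt_iff_le_not_ge, hle, hle, ← lt_iff_le_not_ge]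
  have hinj : Function.Injective e := fun a b h => le_antisymm ((hle a b).1 h.le) ((hle b a).1 h.ge)
  have hsurj : Function.Surjective e := fun β => by
    obtain ⟨s, hs, h⟩ := surj t β.1 β.2
    exact ⟨⟨s, hs⟩, Subtype.ext h⟩
  let r : (fun a b : Iio t => a < b) ≃r (fun a b : Iio (len t) => a < b) :=
    ⟨Equiv.ofBijective e ⟨hinj, hsurj⟩, fun {a b} => hlt a b⟩
  have h := Ordinal.lift_type_eq.{u, u + 1, u + 1}.2 ⟨r⟩
  have h2 : Ordinal.lift.{u + 1} (treeHeight t) = Ordinal.lift.{u + 1} (len t) := by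
    refine h.trans ?_
    simp
  exact Ordinal.lift_inj.1 h2

namespace FullTree

variable {κ : Type u} {α : Ordinal.{u}}

/-- The length of a sequence, as an ordinal. -/
noncomputable def length (f : FullTree κ α) : Ordinal.{u} := (Ordinal.ToType.mk.symm f.dom).1

theorem length_lt (f : FullTree κ α) : f.length < α := (Ordinal.ToType.mk.symm f.dom).2

theorem length_le_length {f g : FullTree κ α} : f.length ≤ g.length ↔ f.dom ≤ g.dom :=
  (Ordinal.ToType.mk (o := α)).symm.le_iff_le

theorem exists_coe_eq (f : FullTree κ α) {i : Ordinal.{u}} (hi : i < f.length) :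
    ∃ j : Iio f.dom, (Ordinal.ToType.mk.symm j.1).1 = i := by
  refine ⟨⟨Ordinal.ToType.mk ⟨i, hi.trans f.length_lt⟩, ?_⟩, by simp⟩
  rw [mem_Iio, OrderIso.lt_symm_apply .. |>.symm]
  exact hi

/-- The sequence of length `β` with the entries of `g`. -/
noncomputable def ofDigits (β : Ordinal.{u}) (hβ : β < α) (g : Ordinal.{u} → κ) : FullTree κ α where
  dom := Ordinal.ToType.mk ⟨β, hβ⟩
  val j := g (Ordinal.ToType.mk.symm j.1).1

@[simp] theorem length_ofDigits (β : Ordinal.{u}) (hβ : β < α) (g : Ordinal.{u} → κ) :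
    (ofDigits β hβ g).length = β := by simp [length, ofDigits]

variable [Inhabited κ]

open Classical in
/-- The `i`-th entry of a sequence; by convention it is `default` when `i` is not less than the
length. -/
noncomputable def digit (f : FullTree κ α) (i : Ordinal.{u}) : κ :=
  if h : ∃ j : Iio f.dom, (Ordinal.ToType.mk.symm j.1).1 = i then f.val h.choose else default

theorem digit_coe (f : FullTree κ α) (j : Iio f.dom) :
    f.digit (Ordinal.ToType.mk.symm j.1).1 = f.val j := by
  have h : ∃ k : Iio f.dom, (Ordinal.ToType.mk.symm k.1).1 = (Ordinal.ToType.mk.symm j.1).1 :=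
    ⟨j, rfl⟩
  have h2 : h.choose = j :=
    Subtype.ext (Ordinal.ToType.mk.symm.injective (Subtype.ext h.choose_spec))
  rw [digit, dif_pos h, h2]

/-- The order in terms of lengths and digits. -/
theorem le_iff {f g : FullTree κ α} :
    f ≤ g ↔ f.length ≤ g.length ∧ ∀ i < f.length, f.digit i = g.digit i := by
  rw [le_def]
  constructor
  · rintro ⟨h, hv⟩
    refine ⟨length_le_length.2 h, fun i hi => ?_⟩
    obtain ⟨j, rfl⟩ := f.exists_coe_eq hi
    rw [digit_coe, ← hv j]
    exact (g.digit_coe ⟨j, lt_of_lt_of_le j.2 h⟩).symm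
  · rintro ⟨h, hv⟩
    have h' := length_le_length.1 h
    refine ⟨h', fun j => ?_⟩
    rw [← digit_coe, ← digit_coe, hv]
    have hj : j.1 < f.dom := j.2
    exact (Ordinal.ToType.mk (o := α)).symm.lt_iff_lt.2 hj

theorem digit_ofDigits {β : Ordinal.{u}} (hβ : β < α) (g : Ordinal.{u} → κ) {i : Ordinal.{u}}
    (hi : i < β) : (ofDigits β hβ g).digit i = g i := by
  obtain ⟨j, rfl⟩ := (ofDigits β hβ g).exists_coe_eq (by simpa using hi)
  rw [digit_coe]
  rfl

theorem length_mono {f g : FullTree κ α} (h : f ≤ g) : f.length ≤ g.length := (le_iff.1 h).1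

theorem eq_of_le_of_length_le {f g : FullTree κ α} (h : f ≤ g) (h' : g.length ≤ f.length) :
    f = g := by
  obtain ⟨_, hd⟩ := le_iff.1 h
  exact le_antisymm h (le_iff.2 ⟨h', fun i hi => (hd i (hi.trans_le h')).symm⟩)

theorem length_strictMono {f g : FullTree κ α} (h : f < g) : f.length < g.length :=
  lt_of_not_ge fun h' => h.ne (eq_of_le_of_length_le h.le h')

theorem treeHeight_eq (f : FullTree κ α) : treeHeight f = f.length := by
  refine treeHeight_eq_of_len length (fun _ _ => length_strictMono)
    (fun t a b ha hb h => le_of_dom_le ha.le hb.le (length_le_length.1 h)) (fun t β hβ => ?_) f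
  have hβ' := hβ.trans t.length_lt
  have hle : ofDigits β hβ' t.digit ≤ t :=
    le_iff.2 ⟨by simpa using hβ.le, fun i hi => digit_ofDigits _ _ (by simpa using hi)⟩
  refine ⟨ofDigits β hβ' t.digit, lt_of_le_of_ne hle ?_, by simp⟩
  intro h
  have := congrArg length h
  simp only [length_ofDigits] at this
  exact hβ.ne this

end FullTree

/-! ### One-successor subtrees -/

/-- The full binary tree of height `ω₁ + 2`. -/
abbrev BinTree : Type := FullTree (Fin 2) (ω₁ + 2)

theorem lt_omega_one_add_two {β : Ordinal.{0}} : β < ω₁ + 2 ↔ β ≤ ω₁ + 1 := by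
  rw [← one_add_one_eq_two, ← add_assoc, Order.lt_add_one_iff]

theorem countable_Iio_of_lt_omega_one {β : Ordinal.{0}} (h : β < ω₁) : (Iio β).Countable := by
  rw [← Cardinal.le_aleph0_iff_set_countable, Cardinal.mk_Iio_ordinal,
    ← Cardinal.lift_aleph0.{1, 0}, Cardinal.lift_le, ← Cardinal.lt_aleph_one_iff]
  exact Cardinal.lt_omega_iff_card_lt.1 h

/-- The heights in a subset of the binary tree that contains all nodes on the levels up to `ω₁`
are the lengths. -/
theorem treeHeight_coe {T : Set BinTree} (hT : ∀ f : BinTree, f.length ≤ ω₁ → f ∈ T)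
    (t : T) : treeHeight t = t.1.length := by
  refine treeHeight_eq_of_len (fun t : T => t.1.length) (fun _ _ => FullTree.length_strictMono)
    (fun t a b ha hb h => FullTree.le_of_dom_le (f := a.1) (g := b.1) (k := t.1) ha.le hb.le
      (FullTree.length_le_length.1 h)) (fun t β hβ => ?_) t
  have hβ' := hβ.trans t.1.length_lt
  have hβω : β ≤ ω₁ := Order.lt_add_one_iff.1 (hβ.trans_le (lt_omega_one_add_two.1 t.1.length_lt))
  refine ⟨⟨FullTree.ofDigits β hβ' t.1.digit, hT _ (by simpa using hβω)⟩, lt_of_le_of_ne ?_ ?_,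
    by simp⟩
  · exact FullTree.le_iff.2
      ⟨by simpa using hβ.le, fun i hi => FullTree.digit_ofDigits _ _ (by simpa using hi)⟩
  · intro h
    have := congrArg (fun s : T => s.1.length) h
    simp only [FullTree.length_ofDigits] at this
    exact hβ.ne this

/-- The nodes of length at most `ω₁` together with the nodes of length `ω₁ + 1` whose last entry
is `0` form a subtree as required. -/
theorem exists_isOneSuccessorSubtree : ∃ T : Set BinTree, IsOneSuccessorSubtree T := by
  let T : Set BinTree := {f | f.length ≤ ω₁ ∨ f.digit ω₁ = 0}
  have hT : ∀ f : BinTree, f.length ≤ ω₁ → f ∈ T := fun f hf => Or.inl hf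
  refine ⟨T, fun f hf => hT f (by rwa [FullTree.treeHeight_eq] at hf), fun t ht => ?_⟩
  have htl : t.1.length = ω₁ := (treeHeight_coe hT t).symm.trans ht
  have hlt : ω₁ + 1 < (ω₁ + 2 : Ordinal.{0}) := lt_omega_one_add_two.2 le_rfl
  let g : Ordinal.{0} → Fin 2 := fun i => if i = ω₁ then 0 else t.1.digit i
  have hg : FullTree.ofDigits (ω₁ + 1) hlt g ∈ T := Or.inr <| by
    rw [FullTree.digit_ofDigits _ _ (lt_add_one _)]
    simp [g]
  refine ⟨⟨_, hg⟩, ⟨lt_of_le_of_ne ?_ ?_, ?_⟩, ?_⟩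
  · refine FullTree.le_iff.2 ⟨?_, fun i hi => ?_⟩
    · simp [htl]
    · rw [htl] at hi
      rw [FullTree.digit_ofDigits _ _ (hi.trans (lt_add_one _))]
      simp [g, hi.ne]
  · intro h
    have := congrArg (fun s : T => s.1.length) h
    simp [htl] at this
  · rw [treeHeight_coe hT, treeHeight_coe hT, htl]
    simp
  · rintro s ⟨hts, hs⟩
    rw [treeHeight_coe hT, treeHeight_coe hT, htl] at hs
    have hle := FullTree.le_iff.1 (show t.1 ≤ s.1 from hts.le)
    apply le_antisymm
    all_goals
      refine FullTree.le_iff.2 ⟨by simp [hs], fun i hi => ?_⟩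
      have hi' : i < ω₁ + 1 := by simpa [hs] using hi
      rw [FullTree.digit_ofDigits _ _ hi']
      rcases eq_or_lt_of_le (Order.lt_add_one_iff.1 hi') with rfl | hi2
      · have : s.1.digit ω₁ = 0 := s.2.resolve_left (by simp [hs])
        simp [g, this]
      · have := hle.2 i (by rwa [htl])
        simp [g, hi2.ne, this]

namespace IsOneSuccessorSubtree

variable {T : Set BinTree}

theorem length_le (t : T) : t.1.length ≤ ω₁ + 1 := lt_omega_one_add_two.1 t.1.length_lt

theorem length_mono {s t : T} (h : s ≤ t) : s.1.length ≤ t.1.length := FullTree.length_mono h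

theorem length_strictMono {s t : T} (h : s < t) : s.1.length < t.1.length :=
  FullTree.length_strictMono h

theorem digit_eq {s t : T} (h : s ≤ t) {i : Ordinal.{0}} (hi : i < s.1.length) :
    s.1.digit i = t.1.digit i := (FullTree.le_iff.1 (show s.1 ≤ t.1 from h)).2 i hi

theorem le_iff {s t : T} :
    s ≤ t ↔ s.1.length ≤ t.1.length ∧ ∀ i < s.1.length, s.1.digit i = t.1.digit i :=
  FullTree.le_iff (f := s.1) (g := t.1)

theorem eq_of_le_of_length_le {s t : T} (h : s ≤ t) (h' : t.1.length ≤ s.1.length) : s = t :=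
  Subtype.ext (FullTree.eq_of_le_of_length_le h h')

theorem le_of_length_le {s t u : T} (hs : s ≤ u) (ht : t ≤ u) (h : s.1.length ≤ t.1.length) :
    s ≤ t :=
  FullTree.le_of_dom_le (f := s.1) (g := t.1) (k := u.1) hs ht (FullTree.length_le_length.1 h)

theorem le_total_of_le {s t u : T} (hs : s ≤ u) (ht : t ≤ u) : s ≤ t ∨ t ≤ s :=
  (le_total s.1.length t.1.length).imp (le_of_length_le hs ht) (le_of_length_le ht hs)

theorem exists_digit_ne {s t : T} (h : ¬ s ≤ t) (hl : s.1.length ≤ t.1.length) :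
    ∃ i < s.1.length, s.1.digit i ≠ t.1.digit i := by
  by_contra! hc
  exact h (le_iff.2 ⟨hl, hc⟩)

variable (hT : IsOneSuccessorSubtree T)
include hT

theorem mem_of_length_le (f : BinTree) (hf : f.length ≤ ω₁) : f ∈ T :=
  hT.mem_of_height_le f (by rwa [FullTree.treeHeight_eq])

theorem treeHeight_eq (t : T) : treeHeight t = t.1.length := treeHeight_coe hT.mem_of_length_le t

/-- The node of length `β` with the entries of `g`. -/
noncomputable def node (β : Ordinal.{0}) (hβ : β ≤ ω₁) (g : Ordinal.{0} → Fin 2) : T :=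
  ⟨FullTree.ofDigits β (lt_omega_one_add_two.2 (hβ.trans le_self_add)) g,
    hT.mem_of_length_le _ (by simpa using hβ)⟩

@[simp] theorem length_node (β : Ordinal.{0}) (hβ : β ≤ ω₁) (g : Ordinal.{0} → Fin 2) :
    (hT.node β hβ g).1.length = β := FullTree.length_ofDigits ..

theorem digit_node {β : Ordinal.{0}} (hβ : β ≤ ω₁) (g : Ordinal.{0} → Fin 2) {i : Ordinal.{0}}
    (hi : i < β) : (hT.node β hβ g).1.digit i = g i := FullTree.digit_ofDigits _ _ hi

theorem node_le {β : Ordinal.{0}} (hβ : β ≤ ω₁) {g : Ordinal.{0} → Fin 2} {t : T}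
    (h : β ≤ t.1.length) (hg : ∀ i < β, g i = t.1.digit i) : hT.node β hβ g ≤ t :=
  le_iff.2 ⟨by simpa using h, fun i hi => by
    have hi' : i < β := by simpa using hi
    rw [digit_node _ _ _ hi', hg i hi']⟩

theorem le_node {β : Ordinal.{0}} (hβ : β ≤ ω₁) {g : Ordinal.{0} → Fin 2} {t : T}
    (h : t.1.length ≤ β) (hg : ∀ i < t.1.length, t.1.digit i = g i) : t ≤ hT.node β hβ g :=
  le_iff.2 ⟨by simpa using h, fun i hi => by rw [digit_node _ _ _ (hi.trans_le h), hg i hi]⟩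

theorem exists_le_length_eq (t : T) {β : Ordinal.{0}} (hβ : β ≤ t.1.length) :
    ∃ s ≤ t, s.1.length = β := by
  by_cases h : β ≤ ω₁
  · exact ⟨hT.node β h t.1.digit, hT.node_le h hβ fun _ _ => rfl, by simp⟩
  · exact ⟨t, le_rfl, le_antisymm
      ((length_le t).trans (Order.add_one_le_of_lt (not_le.1 h))) hβ⟩

theorem existsUnique_leaf {t : T} (ht : t.1.length = ω₁) :
    ∃! s : T, t < s ∧ s.1.length = ω₁ + 1 := by
  have := hT.existsUnique_succ t ((hT.treeHeight_eq t).trans ht)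
  simpa [immediateSuccs, hT.treeHeight_eq, ht] using this

/-- Above every node there is a leaf. -/
theorem exists_leaf_ge (s : T) : ∃ l, s ≤ l ∧ l.1.length = ω₁ + 1 := by
  rcases eq_or_lt_of_le (length_le s) with h | h
  · exact ⟨s, le_rfl, h⟩
  · have hs := Order.lt_add_one_iff.1 h
    obtain ⟨l, hl, -⟩ := hT.existsUnique_leaf (hT.length_node ω₁ le_rfl s.1.digit)
    exact ⟨l, (hT.le_node le_rfl hs fun _ _ => rfl).trans hl.1.le, hl.2⟩

/-- Two leaves with the same predecessor on level `ω₁` are equal: this is where the uniqueness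
of the immediate successor enters. -/
theorem leaf_unique {a b : T} (ha : a.1.length = ω₁ + 1) (hb : b.1.length = ω₁ + 1)
    (h : ∀ i < ω₁, a.1.digit i = b.1.digit i) : a = b := by
  have hlt : ∀ c : T, c.1.length = ω₁ + 1 → (∀ i < ω₁, a.1.digit i = c.1.digit i) →
      hT.node ω₁ le_rfl a.1.digit < c := fun c hc hd =>
    lt_of_le_of_ne (hT.node_le le_rfl (hc ▸ le_self_add) hd) fun h => by
      have := congrArg (fun s : T => s.1.length) h
      simp [hc] at this
  exact (hT.existsUnique_leaf (hT.length_node ω₁ le_rfl a.1.digit)).unique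
    ⟨hlt a ha fun _ _ => rfl, ha⟩ ⟨hlt b hb h, hb⟩

end IsOneSuccessorSubtree

namespace IsOneSuccessorSubtree

variable {T : Set BinTree}

/-! ### Nodes on successor levels and suprema of chains -/

/-- The length of `t` is a successor ordinal. -/
def IsSucc (t : T) : Prop := ∃ β : Ordinal.{0}, t.1.length = β + 1

theorem length_lt_of_isSucc {t : T} (ht : IsSucc t) (h : t.1.length ≤ ω₁) : t.1.length < ω₁ := by
  obtain ⟨β, hβ⟩ := ht
  refine lt_of_le_of_ne h fun h' => ?_
  have := (Cardinal.isSuccLimit_omega 1).add_one_lt (show β < ω₁ by rw [← h', hβ]; exact lt_add_one β)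
  rw [← hβ, h'] at this
  exact this.false

theorem le_of_length_eq_zero {t : T} (h : t.1.length = 0) (z : T) : t ≤ z :=
  le_iff.2 ⟨by simp [h], fun i hi => by simp [h] at hi⟩

variable (hT : IsOneSuccessorSubtree T)
include hT

theorem exists_succ_le {x y : T} (h : x.1.length < y.1.length) :
    ∃ s ≤ y, s.1.length = x.1.length + 1 :=
  hT.exists_le_length_eq y (Order.add_one_le_of_lt h)

/-- A node is determined by the nodes on successor levels below it. -/
theorem le_of_forall_isSucc {x y : T} (h : ∀ s, IsSucc s → s ≤ x → s ≤ y) : x ≤ y := by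
  refine le_iff.2 ⟨?_, fun i hi => ?_⟩
  · by_contra! hlt
    obtain ⟨s, hs, hl⟩ := hT.exists_succ_le hlt
    have := length_mono (h s ⟨_, hl⟩ hs)
    rw [hl] at this
    exact (lt_add_one _).not_ge this
  · obtain ⟨s, hs, hl⟩ := hT.exists_le_length_eq x (Order.add_one_le_of_lt hi)
    have hi' : i < s.1.length := hl ▸ lt_add_one i
    rw [← digit_eq hs hi', digit_eq (h s ⟨_, hl⟩ hs) hi']

theorem eq_of_forall_isSucc {x y : T} (h : ∀ s, IsSucc s → (s ≤ x ↔ s ≤ y)) : x = y :=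
  le_antisymm (hT.le_of_forall_isSucc fun s hs => (h s hs).1)
    (hT.le_of_forall_isSucc fun s hs => (h s hs).2)

/-- Every chain has a supremum, and the nodes on successor levels that are below the supremum are
those that are below an element of the chain. -/
theorem exists_sup {C : Set T} (hC : ∀ a ∈ C, ∀ b ∈ C, a ≤ b ∨ b ≤ a) :
    ∃ y : T, ∀ s, IsSucc s → (s ≤ y ↔ ∃ c ∈ C, s ≤ c) := by
  by_cases hmax : ∃ c ∈ C, c.1.length = ω₁ + 1
  · obtain ⟨c, hc, hl⟩ := hmax
    refine ⟨c, fun s _ => ⟨fun h => ⟨c, hc, h⟩, ?_⟩⟩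
    rintro ⟨d, hd, hsd⟩
    rcases hC d hd c hc with h | h
    · exact hsd.trans h
    · rwa [eq_of_le_of_length_le h (hl ▸ length_le d)]
  · push Not at hmax
    have hle : ∀ c ∈ C, c.1.length ≤ ω₁ := fun c hc =>
      Order.lt_add_one_iff.1 (lt_of_le_of_ne (length_le c) (hmax c hc))
    classical
    let g : Ordinal.{0} → Fin 2 := fun i =>
      if h : ∃ c ∈ C, i < c.1.length then h.choose.1.digit i else 0
    have hg : ∀ c ∈ C, ∀ i < c.1.length, c.1.digit i = g i := fun c hc i hi => by
      have h : ∃ c ∈ C, i < c.1.length := ⟨c, hc, hi⟩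
      obtain ⟨h1, h2⟩ := h.choose_spec
      simp only [g, dif_pos h]
      rcases hC c hc _ h1 with h' | h'
      · exact digit_eq h' hi
      · exact (digit_eq h' h2).symm
    let β := sSup ((fun c : T => c.1.length) '' C)
    have hub : ω₁ ∈ upperBounds ((fun c : T => c.1.length) '' C) := by
      rintro _ ⟨c, hc, rfl⟩
      exact hle c hc
    have hβ : β ≤ ω₁ := csSup_le' hub
    have hCβ : ∀ c ∈ C, c ≤ hT.node β hβ g := fun c hc =>
      hT.le_node hβ (le_csSup ⟨_, hub⟩ ⟨c, hc, rfl⟩) (hg c hc)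
    refine ⟨hT.node β hβ g, fun s hs => ⟨fun h => ?_, ?_⟩⟩
    · obtain ⟨δ, hδ⟩ := hs
      have hlt : δ < β := by
        have := length_mono h
        rw [hδ, length_node] at this
        exact Order.add_one_le_iff.1 this
      obtain ⟨_, ⟨c, hc, rfl⟩, hδc⟩ := exists_lt_of_lt_csSup' hlt
      exact ⟨c, hc, le_of_length_le h (hCβ c hc) (hδ ▸ Order.add_one_le_of_lt hδc)⟩
    · rintro ⟨c, hc, hsc⟩
      exact hsc.trans (hCβ c hc)

/-- Two distinct nodes on successor levels have only countably many common predecessors: they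
branch at a countable level, since no node on level `ω₁` has two immediate successors. -/
theorem countable_le_and_le {a b : T} (ha : IsSucc a) (hb : IsSucc b) (hab : a ≠ b) :
    {s : T | s ≤ a ∧ s ≤ b}.Countable := by
  suffices h : ∃ δ < ω₁, ∀ s, s ≤ a → s ≤ b → s.1.length ≤ δ by
    obtain ⟨δ, hδ, h⟩ := h
    refine MapsTo.countable_of_injOn (f := fun s : T => s.1.length) (t := Iio (δ + 1)) ?_ ?_
      (countable_Iio_of_lt_omega_one ((Cardinal.isSuccLimit_omega 1).add_one_lt hδ))
    · exact fun s hs => Order.lt_add_one_iff.2 (h s hs.1 hs.2)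
    · exact fun s hs t ht hst => le_antisymm (le_of_length_le hs.1 ht.1 hst.le)
        (le_of_length_le ht.1 hs.1 hst.ge)
  wlog hl : a.1.length ≤ b.1.length generalizing a b
  · obtain ⟨δ, hδ, h⟩ := this hb ha hab.symm (le_of_not_ge hl)
    exact ⟨δ, hδ, fun s h1 h2 => h s h2 h1⟩
  by_cases haω : a.1.length ≤ ω₁
  · exact ⟨_, length_lt_of_isSucc ha haω, fun s hs _ => length_mono hs⟩
  · have ha' : a.1.length = ω₁ + 1 :=
      le_antisymm (length_le a) (Order.add_one_le_of_lt (not_le.1 haω))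
    have hb' : b.1.length = ω₁ + 1 := le_antisymm (length_le b) (ha' ▸ hl)
    obtain ⟨i, hi, hne⟩ : ∃ i < ω₁, a.1.digit i ≠ b.1.digit i := by
      by_contra! h
      exact hab (hT.leaf_unique ha' hb' h)
    refine ⟨i, hi, fun s h1 h2 => ?_⟩
    by_contra! hlt
    exact hne ((digit_eq h1 hlt).symm.trans (digit_eq h2 hlt))

/-! ### The coarse wedge topology -/

omit hT in
/-- The subtree carries its coarse wedge topology. -/
noncomputable local instance instCoarseWedge (T : Set BinTree) : TopologicalSpace T := coarseWedgeTopology T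

theorem isClopen_Ici {t : T} (ht : IsSucc t) : IsClopen (Ici t) := by
  have h : IsMinOrSuccLevel t := Or.inr <| ht.imp fun β hβ => (hT.treeHeight_eq t).trans hβ
  exact ⟨⟨TopologicalSpace.isOpen_generateFrom_of_mem ⟨t, h, Or.inr rfl⟩⟩,
    TopologicalSpace.isOpen_generateFrom_of_mem ⟨t, h, Or.inl rfl⟩⟩

theorem length_eq_zero_or_isSucc {t : T} (ht : IsMinOrSuccLevel t) :
    t.1.length = 0 ∨ IsSucc t := by
  rcases ht with ht | ⟨β, hβ⟩
  · obtain ⟨s, hs, h0⟩ := hT.exists_le_length_eq t zero_le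
    exact Or.inl (nonpos_iff_eq_zero.1 (h0 ▸ length_mono (ht hs)))
  · exact Or.inr ⟨β, (hT.treeHeight_eq t).symm.trans hβ⟩

/-- A filter converges to `x` if it contains the wedges of the successor-level nodes below `x` and
the complements of the other ones: a wedge of a minimal node is the whole tree. -/
theorem le_nhds {F : Filter T} {x : T}
    (h : ∀ s, IsSucc s → (s ≤ x → Ici s ∈ F) ∧ (¬ s ≤ x → (Ici s)ᶜ ∈ F)) : F ≤ 𝓝 x := by
  rw [TopologicalSpace.nhds_generateFrom]
  refine le_iInf₂ fun U hU => ?_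
  obtain ⟨hx, t, ht, hU⟩ := hU
  rw [le_principal_iff]
  rcases hT.length_eq_zero_or_isSucc ht with h0 | hs
  · have hle := le_of_length_eq_zero h0
    rcases hU with rfl | rfl
    · exact mem_of_superset univ_mem fun z _ => hle z
    · exact absurd (hle x) hx
  · rcases hU with rfl | rfl
    · exact (h t hs).1 hx
    · exact (h t hs).2 hx

theorem tendsto_nhds {ι : Type*} {l : Filter ι} {f : ι → T} {x : T}
    (h : ∀ s, IsSucc s → ∀ᶠ a in l, (s ≤ f a ↔ s ≤ x)) : Tendsto f l (𝓝 x) :=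
  hT.le_nhds fun s hs => ⟨fun hx => (h s hs).mono fun _ ha => ha.2 hx,
    fun hx => (h s hs).mono fun _ ha hc => hx (ha.1 hc)⟩

theorem continuous_of_isClopen {X : Type*} [TopologicalSpace X] {f : X → T}
    (h : ∀ s, IsSucc s → IsClopen {a | s ≤ f a}) : Continuous f := by
  refine continuous_iff_continuousAt.2 fun a => hT.tendsto_nhds fun s hs => ?_
  by_cases ha : s ≤ f a
  · filter_upwards [(h s hs).isOpen.mem_nhds ha] with b hb
    exact iff_of_true hb ha
  · filter_upwards [(h s hs).compl.isOpen.mem_nhds ha] with b hb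
    exact iff_of_false hb ha

/-- The limit of an ultrafilter is the supremum of the chain of the nodes whose wedges it
contains. -/
theorem compactSpace : CompactSpace T := by
  refine ⟨isCompact_iff_ultrafilter_le_nhds.2 fun F _ => ?_⟩
  obtain ⟨y, hy⟩ := hT.exists_sup (C := {t | IsSucc t ∧ Ici t ∈ F}) fun a ha b hb => by
    obtain ⟨z, h1, h2⟩ := F.nonempty_of_mem (inter_mem ha.2 hb.2)
    exact le_total_of_le h1 h2
  refine ⟨y, mem_univ y, hT.le_nhds fun s hs => ⟨fun h => ?_, fun h => ?_⟩⟩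
  · obtain ⟨c, hc, hsc⟩ := (hy s hs).1 h
    exact mem_of_superset hc.2 (Ici_subset_Ici.2 hsc)
  · exact Ultrafilter.compl_mem_iff_notMem.2 fun hF => h ((hy s hs).2 ⟨s, ⟨hs, hF⟩, le_rfl⟩)

theorem t2Space : T2Space T := by
  refine ⟨fun x y hxy => ?_⟩
  wlog h : ¬ x ≤ y generalizing x y
  · obtain ⟨U, V, hU, hV, hx, hy, hd⟩ := this _ _ hxy.symm fun h' => hxy (le_antisymm (not_not.1 h) h')
    exact ⟨V, U, hV, hU, hy, hx, hd.symm⟩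
  obtain ⟨s, hs, hsx, hsy⟩ : ∃ s, IsSucc s ∧ s ≤ x ∧ ¬ s ≤ y := by
    by_contra! hc
    exact h (hT.le_of_forall_isSucc hc)
  exact ⟨Ici s, (Ici s)ᶜ, (hT.isClopen_Ici hs).isOpen, (hT.isClopen_Ici hs).compl.isOpen, hsx, hsy,
    disjoint_compl_right⟩

/-- The basic neighbourhoods of a node on a limit level: the wedges of its strict predecessors,
minus what is strictly above the node. -/
theorem exists_lt_forall_mem {x : T} (hx : IsSuccLimit x.1.length) {U : Set T} (hU : IsOpen U)
    (hxU : x ∈ U) : ∃ t < x, ∀ z, t ≤ z → ¬ x < z → z ∈ U := by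
  have hlt : ∀ s ≤ x, s.1.length < x.1.length → s < x := fun s hs hl =>
    lt_of_le_of_ne hs fun h => hl.ne (by rw [h])
  obtain ⟨t₀, ht₀, hl₀⟩ := hT.exists_le_length_eq x zero_le
  have ht₀' : t₀ < x := hlt _ ht₀ (hl₀ ▸ hx.bot_lt)
  induction hU with
  | basic U hU =>
    obtain ⟨s, hs, hU⟩ := hU
    have hs' := hT.length_eq_zero_or_isSucc hs
    have hne : s ≠ x := by
      rintro rfl
      rcases hs' with h | ⟨β, h⟩
      · exact hx.bot_lt.ne' h
      · rw [h] at hx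
        exact (hx.add_one_lt (lt_add_one β)).false
    rcases hU with rfl | rfl
    · exact ⟨s, lt_of_le_of_ne hxU hne, fun z hz _ => hz⟩
    · by_cases hxs : x ≤ s
      · exact ⟨t₀, ht₀', fun z _ hz hsz => hz ((lt_of_le_of_ne hxs hne.symm).trans_le hsz)⟩
      · obtain ⟨i, hix, his, hd⟩ : ∃ i, i < x.1.length ∧ i < s.1.length ∧
            x.1.digit i ≠ s.1.digit i := by
          rcases le_total x.1.length s.1.length with hl | hl
          · obtain ⟨i, hi, hd⟩ := exists_digit_ne hxs hl
            exact ⟨i, hi, hi.trans_le hl, hd⟩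
          · obtain ⟨i, hi, hd⟩ := exists_digit_ne hxU hl
            exact ⟨i, hi.trans_le hl, hi, hd.symm⟩
        obtain ⟨t, ht, htl⟩ := hT.exists_le_length_eq x (hx.add_one_lt hix).le
        refine ⟨t, hlt t ht (htl ▸ hx.add_one_lt hix), fun z htz _ hsz => hd ?_⟩
        have hit : i < t.1.length := htl ▸ lt_add_one i
        rw [← digit_eq ht hit, digit_eq htz hit, digit_eq hsz his]
  | univ => exact ⟨t₀, ht₀', fun z _ _ => mem_univ z⟩
  | inter U V _ _ ihU ihV =>
    obtain ⟨t, ht, hU⟩ := ihU hxU.1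
    obtain ⟨t', ht', hV⟩ := ihV hxU.2
    rcases le_total_of_le ht.le ht'.le with h | h
    · exact ⟨t', ht', fun z hz hxz => ⟨hU z (h.trans hz) hxz, hV z hz hxz⟩⟩
    · exact ⟨t, ht, fun z hz hxz => ⟨hU z hz hxz, hV z (h.trans hz) hxz⟩⟩
  | sUnion S _ ih =>
    obtain ⟨U, hU, hxU⟩ := hxU
    obtain ⟨t, ht, h⟩ := ih U hU hxU
    exact ⟨t, ht, fun z hz hxz => ⟨U, hU, h z hz hxz⟩⟩

/-! ### The retractional skeleton -/

omit hT in
/-- A countable set of nodes on successor levels that contains, with any two distinct nodes,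
their common predecessors on successor levels. -/
structure IsMeetClosed (A : Set T) : Prop where
  countable : A.Countable
  isSucc : ∀ a ∈ A, IsSucc a
  mem_of_le : ∀ a ∈ A, ∀ b ∈ A, a ≠ b → ∀ s, IsSucc s → s ≤ a → s ≤ b → s ∈ A

theorem exists_isMeetClosed_superset {A : Set T} (hA : A.Countable) (hs : ∀ a ∈ A, IsSucc a) :
    ∃ B, A ⊆ B ∧ IsMeetClosed B := by
  let D : Set T := {s | IsSucc s ∧ ∃ a ∈ A, ∃ b ∈ A, a ≠ b ∧ s ≤ a ∧ s ≤ b}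
  have hD : D.Countable := by
    have h : (⋃ a ∈ A, ⋃ b ∈ A, ⋃ _ : a ≠ b, {s : T | s ≤ a ∧ s ≤ b}).Countable :=
      hA.biUnion fun a ha => hA.biUnion fun b hb => countable_iUnion fun hab =>
        hT.countable_le_and_le (hs a ha) (hs b hb) hab
    refine h.mono ?_
    rintro s ⟨-, a, ha, b, hb, hab, h⟩
    simp only [mem_iUnion]
    exact ⟨a, ha, b, hb, hab, h⟩
  refine ⟨A ∪ D, subset_union_left, hA.union hD, ?_, ?_⟩
  · rintro a (ha | ha)
    exacts [hs a ha, ha.1]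
  · rintro a (ha | ⟨-, c, hc, d, hd, hcd, hac, had⟩) b hb hab s hsucc hsa hsb
    · rcases hb with hb | ⟨-, c, hc, d, hd, hcd, hbc, hbd⟩
      · exact Or.inr ⟨hsucc, a, ha, b, hb, hab, hsa, hsb⟩
      · exact Or.inr ⟨hsucc, c, hc, d, hd, hcd, hsb.trans hbc, hsb.trans hbd⟩
    · exact Or.inr ⟨hsucc, c, hc, d, hd, hcd, hsa.trans hac, hsa.trans had⟩

/-- The retraction given by a set `A` of nodes: `x` is mapped to the supremum of the elements of
`A` below `x`. -/
noncomputable def retract (A : Set T) (x : T) : T :=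
  (hT.exists_sup (C := {a | a ∈ A ∧ a ≤ x}) fun _ ha _ hb => le_total_of_le ha.2 hb.2).choose

theorem le_retract_iff {A : Set T} {x s : T} (hs : IsSucc s) :
    s ≤ hT.retract A x ↔ ∃ a ∈ A, a ≤ x ∧ s ≤ a := by
  refine (Exists.choose_spec (hT.exists_sup (C := {a | a ∈ A ∧ a ≤ x})
    fun _ ha _ hb => le_total_of_le ha.2 hb.2) s hs).trans ?_
  simp only [mem_ofPred_eq, and_assoc]

theorem retract_le (A : Set T) (x : T) : hT.retract A x ≤ x :=
  hT.le_of_forall_isSucc fun s hs h => by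
    obtain ⟨a, -, hax, hsa⟩ := (hT.le_retract_iff hs).1 h
    exact hsa.trans hax

theorem mem_le_retract_iff {A : Set T} (hA : ∀ a ∈ A, IsSucc a) {a x : T} (ha : a ∈ A) :
    a ≤ hT.retract A x ↔ a ≤ x :=
  ⟨fun h => h.trans (hT.retract_le A x), fun h => (hT.le_retract_iff (hA a ha)).2 ⟨a, ha, h, le_rfl⟩⟩

theorem retract_retract {A B : Set T} (hB : ∀ b ∈ B, IsSucc b) (h : A ⊆ B) (x : T) :
    hT.retract B (hT.retract A x) = hT.retract A x ∧
      hT.retract A (hT.retract B x) = hT.retract A x := by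
  constructor
  · refine hT.eq_of_forall_isSucc fun s hs => ?_
    rw [hT.le_retract_iff hs]
    refine ⟨fun ⟨b, _, hbx, hsb⟩ => hsb.trans hbx, fun hsx => ?_⟩
    obtain ⟨a, ha, hax, hsa⟩ := (hT.le_retract_iff hs).1 hsx
    exact ⟨a, h ha, (hT.mem_le_retract_iff (fun a ha => hB a (h ha)) ha).2 hax, hsa⟩
  · refine hT.eq_of_forall_isSucc fun s hs => ?_
    rw [hT.le_retract_iff hs, hT.le_retract_iff hs]
    refine exists_congr fun a => and_congr_right fun ha => ?_
    rw [hT.mem_le_retract_iff hB (h ha)]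

/-- For `s` outside `A`, at most one element of `A` is above `s`, so that the preimage of a wedge
is a wedge or empty. -/
theorem continuous_retract {A : Set T} (hA : IsMeetClosed A) : Continuous (hT.retract A) := by
  refine hT.continuous_of_isClopen fun s hs => ?_
  by_cases hsA : s ∈ A
  · have : {x | s ≤ hT.retract A x} = Ici s := by
      ext x
      exact hT.mem_le_retract_iff hA.isSucc hsA
    rw [this]
    exact hT.isClopen_Ici hs
  by_cases hne : ∃ a ∈ A, s ≤ a
  · obtain ⟨a, ha, hsa⟩ := hne
    have : {x | s ≤ hT.retract A x} = Ici a := by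
      ext x
      rw [mem_ofPred_eq, hT.le_retract_iff hs]
      refine ⟨?_, fun hx => ⟨a, ha, hx, hsa⟩⟩
      rintro ⟨b, hb, hbx, hsb⟩
      by_cases hab : a = b
      · exact hab ▸ hbx
      · exact absurd (hA.mem_of_le a ha b hb hab s hs hsa hsb) hsA
    rw [this]
    exact hT.isClopen_Ici (hA.isSucc a ha)
  · have : {x | s ≤ hT.retract A x} = ∅ := by
      refine eq_empty_of_forall_notMem fun x hx => hne ?_
      obtain ⟨a, ha, -, hsa⟩ := (hT.le_retract_iff hs).1 hx
      exact ⟨a, ha, hsa⟩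
    rw [this]
    exact isClopen_empty

/-- The range of the retraction embeds into the Cantor cube `A → Bool`. -/
theorem metrizableSpace_range_retract {A : Set T} (hA : IsMeetClosed A) :
    TopologicalSpace.MetrizableSpace (range (hT.retract A)) := by
  classical
  have := hT.compactSpace
  have := hA.countable.to_subtype
  have : CompactSpace (range (hT.retract A)) :=
    isCompact_iff_compactSpace.1 (isCompact_range (hT.continuous_retract hA))
  let φ : range (hT.retract A) → A → Bool := fun x a => decide (a.1 ≤ x.1)
  have hφ : Continuous φ := by
    refine continuous_pi fun a => ?_
    have hc := hT.isClopen_Ici (hA.isSucc a a.2)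
    refine IsLocallyConstant.continuous ((IsLocallyConstant.iff_exists_open _).2 fun x => ?_)
    by_cases hax : a.1 ≤ x.1
    · refine ⟨_, hc.isOpen.preimage continuous_subtype_val, hax, fun y hy => ?_⟩
      have hy : a.1 ≤ y.1 := hy
      simp [φ, hax, hy]
    · refine ⟨_, hc.compl.isOpen.preimage continuous_subtype_val, hax, fun y hy => ?_⟩
      have hy : ¬ a.1 ≤ y.1 := hy
      simp [φ, hax, hy]
  have hinj : Function.Injective φ := by
    rintro ⟨_, x, rfl⟩ ⟨_, y, rfl⟩ hxy
    refine Subtype.ext (hT.eq_of_forall_isSucc fun s hs => ?_)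
    rw [hT.le_retract_iff hs, hT.le_retract_iff hs]
    refine exists_congr fun a => and_congr_right fun ha => ?_
    have h := congrFun hxy ⟨a, ha⟩
    simp only [φ, decide_eq_decide, hT.mem_le_retract_iff hA.isSucc ha] at h
    rw [h]
  exact (hφ.isClosedEmbedding hinj).isEmbedding.metrizableSpace

theorem hasRetractionalSkeleton : HasRetractionalSkeleton T := by
  have := hT.compactSpace
  refine ⟨{A : Set T // IsMeetClosed A}, inferInstance, fun A => hT.retract A.1, ?_⟩
  constructor
  · obtain ⟨B, -, hB⟩ := hT.exists_isMeetClosed_superset countable_empty (by simp)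
    exact ⟨⟨B, hB⟩⟩
  · intro A B
    obtain ⟨C, hC, hC'⟩ := hT.exists_isMeetClosed_superset (A.2.countable.union B.2.countable)
      (by rintro a (ha | ha); exacts [A.2.isSucc a ha, B.2.isSucc a ha])
    exact ⟨⟨C, hC'⟩, subset_union_left.trans hC, subset_union_right.trans hC⟩
  · exact fun A => hT.continuous_retract A.2
  · exact fun A => funext fun x => (hT.retract_retract A.2.isSucc subset_rfl x).1
  · exact fun A => isCompact_range (hT.continuous_retract A.2)
  · exact fun A => hT.metrizableSpace_range_retract A.2
  · exact fun A B hAB => ⟨funext fun x => (hT.retract_retract B.2.isSucc hAB x).1,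
      funext fun x => (hT.retract_retract B.2.isSucc hAB x).2⟩
  · intro A hA
    have hU : IsMeetClosed (⋃ n, (A n).1) := by
      refine ⟨countable_iUnion fun n => (A n).2.countable, fun a ha => ?_,
        fun a ha b hb hab s hs hsa hsb => ?_⟩
      · obtain ⟨n, hn⟩ := mem_iUnion.1 ha
        exact (A n).2.isSucc a hn
      · obtain ⟨n, hn⟩ := mem_iUnion.1 ha
        obtain ⟨m, hm⟩ := mem_iUnion.1 hb
        exact mem_iUnion.2 ⟨max n m, (A _).2.mem_of_le a (hA (le_max_left n m) hn) b
          (hA (le_max_right n m) hm) hab s hs hsa hsb⟩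
    refine ⟨⟨_, hU⟩, ⟨?_, ?_⟩, fun x => hT.tendsto_nhds fun s hs => ?_⟩
    · rintro _ ⟨n, rfl⟩
      exact subset_iUnion (fun n => (A n).1) n
    · exact fun B hB => iUnion_subset fun n => hB ⟨n, rfl⟩
    · by_cases h : s ≤ hT.retract (⋃ n, (A n).1) x
      · obtain ⟨a, ha, hax, hsa⟩ := (hT.le_retract_iff hs).1 h
        obtain ⟨n, hn⟩ := mem_iUnion.1 ha
        filter_upwards [eventually_ge_atTop n] with m hm
        exact iff_of_true ((hT.le_retract_iff hs).2 ⟨a, hA hm hn, hax, hsa⟩) h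
      · refine Eventually.of_forall fun n => iff_of_false (fun h' => h ?_) h
        obtain ⟨a, ha, hax, hsa⟩ := (hT.le_retract_iff hs).1 h'
        exact (hT.le_retract_iff hs).2 ⟨a, mem_iUnion.2 ⟨n, ha⟩, hax, hsa⟩
  · refine fun x => hT.tendsto_nhds fun s hs => ?_
    obtain ⟨B, hB, hB'⟩ := hT.exists_isMeetClosed_superset (countable_singleton s) (by simpa using hs)
    filter_upwards [eventually_ge_atTop (⟨B, hB'⟩ : {A : Set T // IsMeetClosed A})] with A hA
    exact hT.mem_le_retract_iff A.2.isSucc (hA (hB rfl))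

/-! ### Copies of `[0, ω₂]` -/

/-- Every point is the intersection of at most `ℵ₁` open sets, given by the successor-level nodes
below it and by its immediate successors. -/
theorem exists_isOpen_iInter_eq (x : T) : ∃ (ι : Type) (U : ι → Set T), Cardinal.mk ι ≤ ℵ₁ ∧
    (∀ i, IsOpen (U i) ∧ x ∈ U i) ∧ ∀ y, (∀ i, y ∈ U i) → y = x := by
  let I : Set T := {s | IsSucc s ∧ (s ≤ x ∨ x < s ∧ s.1.length = x.1.length + 1)}
  let U : I → Set T := fun s => {z | s.1 ≤ z ↔ s.1 ≤ x}
  refine ⟨I, U, ?_, fun s => ⟨?_, Iff.rfl⟩, fun y hy => ?_⟩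
  · let e : I → (ω₁ + 2 : Ordinal.{0}).ToType × Fin 2 := fun s => (s.1.1.dom, s.1.1.digit x.1.length)
    have he : Function.Injective e := by
      rintro ⟨s, hs, hs'⟩ ⟨t, ht, ht'⟩ hst
      have h1 : s.1.dom = t.1.dom := congrArg Prod.fst hst
      have h2 : s.1.digit x.1.length = t.1.digit x.1.length := congrArg Prod.snd hst
      have hl : s.1.length = t.1.length :=
        le_antisymm (FullTree.length_le_length.2 h1.le) (FullTree.length_le_length.2 h1.ge)
      have key : ∀ {s t : T}, s ≤ x → t.1.length = x.1.length + 1 → s.1.length ≠ t.1.length :=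
        fun hs ht h => (lt_add_one _).not_ge (ht ▸ h ▸ length_mono hs)
      refine Subtype.ext (show s = t from ?_)
      rcases hs' with hs' | hs' <;> rcases ht' with ht' | ht'
      · exact le_antisymm (le_of_length_le hs' ht' hl.le) (le_of_length_le ht' hs' hl.ge)
      · exact absurd hl (key hs' ht'.2)
      · exact absurd hl.symm (key ht' hs'.2)
      · refine eq_of_le_of_length_le (le_iff.2 ⟨hl.le, fun i hi => ?_⟩) hl.ge
        rcases eq_or_lt_of_le (Order.lt_add_one_iff.1 (hs'.2 ▸ hi)) with rfl | hi
        · exact h2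
        · rw [← digit_eq hs'.1.le hi, digit_eq ht'.1.le hi]
    refine (Cardinal.mk_le_of_injective he).trans ?_
    rw [Cardinal.mk_prod, Cardinal.lift_id, Cardinal.lift_id, Cardinal.mk_toType, Ordinal.card_add,
      Ordinal.card_omega]
    have h : ℵ₀ ≤ ℵ₁ := Cardinal.aleph0_le_aleph 1
    refine Cardinal.mul_le_of_le h (Cardinal.add_le_of_le h le_rfl ?_) ?_
    · exact (by simpa using (Cardinal.natCast_lt_aleph0 (n := 2)).le.trans h)
    · exact (by simpa using (Cardinal.natCast_lt_aleph0 (n := 2)).le.trans h)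
  · by_cases h : s.1 ≤ x
    · have : U s = Ici s.1 := by ext z; simp [U, h]
      exact this ▸ (hT.isClopen_Ici s.2.1).isOpen
    · have : U s = (Ici s.1)ᶜ := by ext z; simp [U, h]
      exact this ▸ (hT.isClopen_Ici s.2.1).compl.isOpen
  · have hxy : x ≤ y := hT.le_of_forall_isSucc fun s hs hsx => (hy ⟨s, hs, Or.inl hsx⟩).2 hsx
    refine (eq_of_le_of_length_le hxy (le_of_not_gt fun hlt => ?_)).symm
    obtain ⟨s, hsy, hl⟩ := hT.exists_succ_le hlt
    have hxs : x < s := lt_of_le_of_ne (le_of_length_le hxy hsy (hl ▸ le_self_add)) fun h => by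
      rw [← h] at hl
      exact (lt_add_one _).ne hl
    exact hxs.not_ge ((hy ⟨s, ⟨_, hl⟩, Or.inr ⟨hxs, hl⟩⟩).1 hsy)

/-- In `[0, ω₂]` an intersection of at most `ℵ₁` neighbourhoods of `ω₂` contains an interval
`(γ, ω₂]`, whereas under an embedding the preimages of the open sets of
`exists_isOpen_iInter_eq` would have the intersection `{ω₂}`. -/
theorem not_containsOmegaTwoCopy : ¬ ContainsOmegaTwoCopy T := by
  rintro ⟨f, hf⟩
  let top : Iic (ω_ 2 : Ordinal.{0}) := ⟨ω_ 2, le_refl (ω_ 2)⟩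
  obtain ⟨ι, U, hι, hU, hx⟩ := hT.exists_isOpen_iInter_eq (f top)
  have hα : ∀ i, ∃ α < (ω_ 2 : Ordinal.{0}), ∀ a : Iic (ω_ 2 : Ordinal.{0}), α < a.1 → f a ∈ U i := by
    intro i
    obtain ⟨V, hV, hVU⟩ := isOpen_induced_iff.1 ((hU i).1.preimage hf.continuous)
    have htop : (ω_ 2 : Ordinal.{0}) ∈ V := by
      have : top ∈ Subtype.val ⁻¹' V := hVU ▸ (hU i).2
      exact this
    obtain ⟨α, hα, h⟩ := exists_Ioc_subset_of_mem_nhds (hV.mem_nhds htop)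
      ⟨0, Ordinal.omega_pos 2⟩
    refine ⟨α, hα, fun a ha => ?_⟩
    have : a ∈ Subtype.val ⁻¹' V := h ⟨ha, a.2⟩
    rwa [hVU] at this
  choose α hα hαU using hα
  have hcof : (ω_ 2 : Ordinal.{0}).cof = ℵ_ 2 := by
    refine Cardinal.IsRegular.cof_omega_eq ?_
    rw [← one_add_one_eq_two]
    exact Cardinal.isRegular_aleph_add_one 1
  have hsup : ⨆ i, α i < ω_ 2 := by
    refine Ordinal.iSup_lt_of_lt_cof (hι.trans_lt ?_) hα
    rw [hcof]
    exact Cardinal.aleph_lt_aleph.2 one_lt_two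
  have hsucc := (Cardinal.isSuccLimit_omega 2).add_one_lt hsup
  let a : Iic (ω_ 2 : Ordinal.{0}) := ⟨(⨆ i, α i) + 1, hsucc.le⟩
  have ha : f a = f top := hx _ fun i =>
    hαU i a ((Ordinal.le_iSup α i).trans_lt (lt_add_one _))
  exact hsucc.ne (congrArg Subtype.val (hf.injective ha))

/-! ### The subtree is not Valdivia -/

section Cube

variable {Γ : Type} {h : T → Γ → unitInterval}

omit hT in
/-- The coordinates that do not vanish anywhere on the wedge of `s`. -/
def nonvanishing (h : T → Γ → unitInterval) (s : T) : Set Γ := {γ | ∀ z, s ≤ z → h z γ ≠ 0}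

omit hT in
theorem nonvanishing_mono {s t : T} (hst : s ≤ t) : nonvanishing h s ⊆ nonvanishing h t :=
  fun _ hγ z hz => hγ z (hst.trans hz)

theorem countable_nonvanishing
    (hc : ∀ l : T, l.1.length = ω₁ + 1 → {γ | h l γ ≠ 0}.Countable) (s : T) :
    (nonvanishing h s).Countable := by
  obtain ⟨l, hsl, hl⟩ := hT.exists_leaf_ge s
  exact (hc l hl).mono fun γ hγ => hγ l hsl

/-- A continuous function that does not vanish at a node on a limit level is nonzero on the wedge
of a node branching off just below it. -/
theorem exists_mem_nonvanishing (hh : Continuous h) {s u : T} (hsu : s < u)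
    (hu : IsSuccLimit u.1.length) (huω : u.1.length ≤ ω₁) {γ : Γ} (hγ : h u γ ≠ 0) :
    ∃ t, s ≤ t ∧ t.1.length ≤ ω₁ ∧ γ ∈ nonvanishing h t := by
  have hopen : IsOpen {z | h z γ ≠ 0} :=
    isOpen_ne_fun ((continuous_apply γ).comp hh) continuous_const
  obtain ⟨r, hr, hrU⟩ := hT.exists_lt_forall_mem hu hopen hγ
  let β := max r.1.length s.1.length
  have hβu : β < u.1.length := max_lt (length_strictMono hr) (length_strictMono hsu)
  have hβω : β + 1 ≤ ω₁ := (hu.add_one_lt hβu).le.trans huω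
  -- the digit at the place `β` differs from that of `u`
  let t := hT.node (β + 1) hβω (Function.update u.1.digit β (u.1.digit β + 1))
  have hle : ∀ v < u, v.1.length ≤ β → v ≤ t := fun v hv hvβ => by
    refine hT.le_node hβω (hvβ.trans le_self_add) fun i hi => ?_
    rw [Function.update_of_ne (hi.trans_le hvβ).ne, digit_eq hv.le hi]
  refine ⟨t, hle s hsu (le_max_right _ _), by simpa [t] using hβω, fun z hz => ?_⟩
  refine hrU z ((hle r hr (le_max_left _ _)).trans hz) fun huz => ?_
  have hβt : β < t.1.length := by simp [t]
  have h1 := (digit_eq hz hβt).trans (digit_eq huz.le hβu).symm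
  rw [hT.digit_node hβω _ (lt_add_one β), Function.update_self] at h1
  simp at h1

/-- Countably many coordinates are constant on a final segment of the branch below a node `x` on
level `ω₁`, while the embedding is injective: this yields a new coordinate that is nonzero on a
wedge. -/
theorem exists_not_nonvanishing_subset (hh : IsEmbedding h)
    (hc : ∀ l : T, l.1.length = ω₁ + 1 → {γ | h l γ ≠ 0}.Countable) {s : T}
    (hs : s.1.length < ω₁) :
    ∃ t, s ≤ t ∧ t.1.length ≤ ω₁ ∧ ¬ nonvanishing h t ⊆ nonvanishing h s := by
  have hF := (hT.countable_nonvanishing hc s).to_subtype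
  let x := hT.node ω₁ le_rfl s.1.digit
  have hxl : x.1.length = ω₁ := hT.length_node ..
  have hxlim : IsSuccLimit x.1.length := by
    rw [hxl]
    exact Cardinal.isSuccLimit_omega 1
  have hsx : s < x := lt_of_le_of_ne (hT.le_node le_rfl hs.le fun _ _ => rfl) fun h => by
    rw [h, hxl] at hs
    exact hs.false
  have hnear : ∀ p : nonvanishing h s × ℕ, ∃ r < x, ∀ z, r ≤ z → ¬ x < z →
      dist (h z p.1) (h x p.1) < 1 / ((p.2 : ℝ) + 1) := fun p => by
    have hopen : IsOpen {z | dist (h z p.1) (h x p.1) < 1 / ((p.2 : ℝ) + 1)} :=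
      isOpen_lt (((continuous_apply p.1.1).comp hh.continuous).dist continuous_const)
        continuous_const
    refine hT.exists_lt_forall_mem hxlim hopen ?_
    change dist (h x p.1) (h x p.1) < _
    rw [dist_self]
    positivity
  choose r hrx hr using hnear
  have hδ : ⨆ p, (r p).1.length < ω₁ :=
    Ordinal.iSup_lt_omega_one fun p => (length_strictMono (hrx p)).trans_eq hxl
  have hadd : ∀ {a b : Ordinal.{0}}, a < ω₁ → b < ω₁ → a + b < ω₁ := fun ha hb =>
    Ordinal.isPrincipal_add_omega 1 ha hb
  let μ := max (⨆ p, (r p).1.length) s.1.length + ω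
  have hμ : μ < ω₁ := hadd (max_lt hδ hs) Ordinal.omega0_lt_omega_one
  obtain ⟨w, hwx, hwl⟩ := hT.exists_le_length_eq x (hμ.le.trans_eq hxl.symm)
  have hlt : ∀ v < x, v.1.length ≤ max (⨆ p, (r p).1.length) s.1.length → v < w := fun v hv hvl => by
    have hvμ : v.1.length < w.1.length :=
      hwl ▸ hvl.trans_lt (lt_add_of_pos_right _ Ordinal.omega0_pos)
    exact lt_of_le_of_ne (le_of_length_le hv.le hwx hvμ.le) fun h => hvμ.ne (by rw [h])
  have heq : ∀ γ ∈ nonvanishing h s, h w γ = h x γ := fun γ hγ => by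
    refine dist_le_zero.1 (le_of_forall_pos_lt_add fun ε hε => ?_)
    obtain ⟨n, hn⟩ := exists_nat_one_div_lt hε
    rw [zero_add]
    refine (hr ⟨⟨γ, hγ⟩, n⟩ w (hlt _ (hrx _) ?_).le hwx.not_gt).trans hn
    exact le_max_of_le_left (Ordinal.le_iSup (fun p => (r p).1.length) _)
  have hwx' : w ≠ x := fun h => by
    rw [h, hxl] at hwl
    exact hμ.ne hwl.symm
  obtain ⟨γ, hγ⟩ := Function.ne_iff.1 (hh.injective.ne hwx')
  have hγs : γ ∉ nonvanishing h s := fun hm => hγ (heq γ hm)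
  have hsw : s < w := hlt s hsx (le_max_right _ _)
  have hwlim : IsSuccLimit w.1.length :=
    hwl ▸ Ordinal.isSuccLimit_add _ Ordinal.isSuccLimit_omega0
  obtain ⟨t, hst, htl, ht⟩ : ∃ t, s ≤ t ∧ t.1.length ≤ ω₁ ∧ γ ∈ nonvanishing h t := by
    by_cases hw0 : h w γ = 0
    · exact hT.exists_mem_nonvanishing hh.continuous hsx hxlim hxl.le fun h0 => hγ (hw0.trans h0.symm)
    · exact hT.exists_mem_nonvanishing hh.continuous hsw hwlim (hwl ▸ hμ.le) hw0
  exact ⟨t, hst, htl, fun hsub => hγs (hsub ht)⟩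

/-- A coordinate that is nonzero on the wedge of a node on level `ω₁` is nonzero on the wedge of
some strict predecessor. By countability, one predecessor serves for all these coordinates. -/
theorem exists_lt_nonvanishing_subset (hh : Continuous h)
    (hc : ∀ l : T, l.1.length = ω₁ + 1 → {γ | h l γ ≠ 0}.Countable) {x : T}
    (hx : x.1.length = ω₁) : ∃ t < x, nonvanishing h x ⊆ nonvanishing h t := by
  have hF := (hT.countable_nonvanishing hc x).to_subtype
  have hlim : IsSuccLimit x.1.length := by
    rw [hx]
    exact Cardinal.isSuccLimit_omega 1
  have hnear : ∀ γ : nonvanishing h x, ∃ r < x, ∀ z, r ≤ z → ¬ x < z → h z γ ≠ 0 := fun γ =>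
    hT.exists_lt_forall_mem hlim
      (isOpen_ne_fun ((continuous_apply γ.1).comp hh) continuous_const) (γ.2 x le_rfl)
  choose r hrx hr using hnear
  have hδ : ⨆ γ, (r γ).1.length < x.1.length :=
    (Ordinal.iSup_lt_omega_one fun γ => (length_strictMono (hrx γ)).trans_eq hx).trans_eq hx.symm
  obtain ⟨t, htx, htl⟩ := hT.exists_le_length_eq x hδ.le
  refine ⟨t, lt_of_le_of_ne htx fun h => hδ.ne (by rw [← htl, h]), fun γ hγ z hz => ?_⟩
  by_cases hxz : x < z
  · exact hγ z hxz.le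
  · refine hr ⟨γ, hγ⟩ z (le_trans (le_of_length_le (hrx _).le htx ?_) hz) hxz
    exact htl ▸ Ordinal.le_iSup (fun γ => (r γ).1.length) _

/-- Whenever the subtree is embedded into a cube, some leaf has uncountable support. Otherwise,
consider the nodes `s` whose set of nonvanishing coordinates is strictly larger than that of every
strict predecessor. By Zorn's lemma there is a maximal one, and it can be neither on a countable
level nor on level `ω₁`. -/
theorem exists_leaf_not_countable (hh : IsEmbedding h) :
    ∃ l : T, l.1.length = ω₁ + 1 ∧ ¬ {γ | h l γ ≠ 0}.Countable := by
  by_contra! hc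
  let P : Set T := {s | s.1.length ≤ ω₁ ∧ ∀ t < s, ¬ nonvanishing h s ⊆ nonvanishing h t}
  obtain ⟨m, hm⟩ : ∃ m, Maximal (· ∈ P) m := by
    refine zorn_le₀ P fun C hCP hC => ?_
    obtain ⟨y, hy⟩ := hT.exists_sup (C := C) fun a ha b hb => hC.total ha hb
    have hCy : ∀ c ∈ C, c ≤ y := fun c hc =>
      hT.le_of_forall_isSucc fun s hs hsc => (hy s hs).2 ⟨c, hc, hsc⟩
    refine ⟨y, ⟨?_, fun t ht hsub => ?_⟩, hCy⟩
    · by_contra! hlt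
      have hl : y.1.length = ω₁ + 1 := le_antisymm (length_le y) (Order.add_one_le_of_lt hlt)
      obtain ⟨c, hc, hyc⟩ := (hy y ⟨_, hl⟩).1 le_rfl
      exact ((length_mono hyc).trans (hCP hc).1).not_gt hlt
    · obtain ⟨s, hsy, hl⟩ := hT.exists_succ_le (length_strictMono ht)
      obtain ⟨c, hc, hsc⟩ := (hy s ⟨_, hl⟩).1 hsy
      have hts : t < s := lt_of_le_of_ne (le_of_length_le ht.le hsy (hl ▸ le_self_add)) fun h => by
        rw [← h] at hl
        exact (lt_add_one _).ne hl
      exact (hCP hc).2 t (hts.trans_le hsc) ((nonvanishing_mono (hCy c hc)).trans hsub)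
  rcases eq_or_lt_of_le hm.prop.1 with hmω | hmω
  · obtain ⟨t, ht, hsub⟩ := hT.exists_lt_nonvanishing_subset hh.continuous hc hmω
    exact hm.prop.2 t ht hsub
  · -- among the nodes above `m` with more nonvanishing coordinates, a shortest one is in `P`
    let Q : Set T := {t | m ≤ t ∧ ¬ nonvanishing h t ⊆ nonvanishing h m}
    obtain ⟨t₀, hmt₀, ht₀, hsub₀⟩ := hT.exists_not_nonvanishing_subset hh hc hmω
    obtain ⟨t, htQ, hmin⟩ := exists_minimalFor_of_wellFoundedLT (· ∈ Q) (fun t : T => t.1.length)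
      ⟨t₀, hmt₀, hsub₀⟩
    have htP : t ∈ P := by
      refine ⟨?_, fun u hu hsub => ?_⟩
      · rcases le_total t.1.length t₀.1.length with h | h
        · exact h.trans ht₀
        · exact (hmin ⟨hmt₀, hsub₀⟩ h).trans ht₀
      · rcases le_total_of_le hu.le htQ.1 with hum | hmu
        · exact htQ.2 (hsub.trans (nonvanishing_mono hum))
        · have hult := length_strictMono hu
          refine (hmin (j := u) ⟨hmu, fun h => htQ.2 (hsub.trans h)⟩ hult.le).not_gt hult
    exact htQ.2 (nonvanishing_mono (hm.le_of_ge htP htQ.1))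

end Cube

/-- The leaves are isolated, hence they belong to every dense set. -/
theorem not_isValdivia : ¬ IsValdivia T := by
  rintro ⟨A, hA, Γ, h, hh, hAΓ⟩
  obtain ⟨l, hl, hlc⟩ := hT.exists_leaf_not_countable hh
  obtain ⟨a, hla, haA⟩ := hA.inter_open_nonempty (Ici l) (hT.isClopen_Ici ⟨_, hl⟩).isOpen
    ⟨l, le_refl l⟩
  obtain rfl := eq_of_le_of_length_le hla (hl ▸ length_le a)
  have : h l ∈ h '' A := ⟨l, haA, rfl⟩
  rw [hAΓ] at this
  exact hlc this.2

end IsOneSuccessorSubtree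

theorem mainTheorem4 :
    (∃ T : Set (FullTree (Fin 2) (Ordinal.omega 1 + 2)), IsOneSuccessorSubtree T) ∧
    (∀ T : Set (FullTree (Fin 2) (Ordinal.omega 1 + 2)), IsOneSuccessorSubtree T →
      letI : TopologicalSpace T := coarseWedgeTopology T
      CompactSpace T ∧ T2Space T ∧ HasRetractionalSkeleton T ∧
        ¬ ContainsOmegaTwoCopy T ∧ ¬ IsValdivia T) ∧
    ¬ (∀ (X : Type) [TopologicalSpace X] [CompactSpace X] [T2Space X],
      HasRetractionalSkeleton X → ¬ ContainsOmegaTwoCopy X → IsValdivia X) := by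
  refine ⟨exists_isOneSuccessorSubtree, fun T hT => ⟨hT.compactSpace, hT.t2Space,
    hT.hasRetractionalSkeleton, hT.not_containsOmegaTwoCopy, hT.not_isValdivia⟩, fun H => ?_⟩
  obtain ⟨T, hT⟩ := exists_isOneSuccessorSubtree
  let _ : TopologicalSpace T := coarseWedgeTopology T
  have := hT.compactSpace
  have := hT.t2Space
  exact hT.not_isValdivia (H T hT.hasRetractionalSkeleton hT.not_containsOmegaTwoCopy)
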